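/- **Theorem 4.1 (Lai).** A non-increasing sequence $\pi=(d_1,\dots,d_n)$ of nonnegative integers is *graphic* if it is the degree sequence of a simple graph of order $n$ (a *realization* of $\pi$), and it is *potentially $H$-graphic* if some realization of $\pi$ contains $H$ as a (not necessarily induced) subgraph; $\sigma(\pi)$ denotes the sum of its terms. Let $\sigma(H,n)$ be the smallest even integer $l\ge 0$ such that every $n$-term graphic sequence $\pi$ of positive integers with $\sigma(\pi)\ge l$ is potentially $H$-graphic. Let $K_5-P_3$ be the graph obtained from the complete graph $K_5$ by removing the three edges of a path $P_3$ on four of its vertices. Then for every $n\ge 5$, $$\sigma(K_5-P_3,\,n)=4n-4 .$$ Moreover, every $n$-term graphic sequence $\pi$ (zero terms allowed) with $\sigma(\pi)\ge 4n-4$ is potentially $K_5-P_3$-graphic, and the sequence $((n-1)^2,2^{n-2})$, that is, $n-1$ taken twice followed by $2$ taken $n-2$ times, is graphic, has positive terms and sum $4n-6$, and is not potentially $K_5-P_3$-graphic. -/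

import Mathlib

namespace PotentiallyGraphic

/-- `G`, a simple graph of order `n`, is a realization of the sequence `d`: its degrees,
in the order of its vertices, are the terms of `d`. -/
def IsRealization {n : ℕ} (G : SimpleGraph (Fin n)) (d : Fin n → ℕ) : Prop :=
  ∀ i, (G.neighborSet i).ncard = d i

/-- A graphic sequence: a non-increasing sequence of `n` nonnegative integers that is the
degree sequence of a simple graph of order `n`. -/
def IsGraphic {n : ℕ} (d : Fin n → ℕ) : Prop :=
  Antitone d ∧ ∃ G : SimpleGraph (Fin n), IsRealization G d

/-- A graphic sequence is potentially `H`-graphic if some realization of it contains `H`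
as a (not necessarily induced) subgraph. -/
def IsPotentially {V : Type*} (H : SimpleGraph V) {n : ℕ} (d : Fin n → ℕ) : Prop :=
  Antitone d ∧ ∃ G : SimpleGraph (Fin n), IsRealization G d ∧ H.IsContained G

/-- The even numbers `l` such that every positive graphic sequence with `n` terms and sum at
least `l` is potentially `H`-graphic. The number `σ(H, n)` is the least element of this set. -/
def sigmaSet {V : Type*} (H : SimpleGraph V) (n : ℕ) : Set ℕ :=
  {l | Even l ∧ ∀ d : Fin n → ℕ, IsGraphic d → (∀ i, 0 < d i) → l ≤ ∑ i, d i →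
    IsPotentially H d}

/-- `s = σ(H, n)`. -/
def IsSigma {V : Type*} (H : SimpleGraph V) (n s : ℕ) : Prop :=
  IsLeast (sigmaSet H n) s

/-- The path `0 - 1 - 2 - 3` with three edges (and four vertices), on the vertices of `K₅`. -/
def pathThree : SimpleGraph (Fin 5) :=
  SimpleGraph.fromEdgeSet {s(0, 1), s(1, 2), s(2, 3)}

/-- `K₅ - P₃`: the complete graph on five vertices with the three edges of a path removed. -/
def K5MinusP3 : SimpleGraph (Fin 5) :=
  (⊤ : SimpleGraph (Fin 5)).deleteEdges pathThree.edgeSet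

/-- The sequence `((n-1)², 2ⁿ⁻²)`. -/
def extremalSeq (n : ℕ) : Fin n → ℕ :=
  fun i => if (i : ℕ) < 2 then n - 1 else 2

end PotentiallyGraphic

/-
`K₅ - P₃` is the gem, a path on four vertices joined to a fifth vertex. For the upper bound, let
`G` be a graph on a set `S` of at least five vertices with at least `2|S| - 2` edges, and delete a
vertex `v` of minimum degree. Unless `G` has minimum degree `3` and exactly `2|S| - 2` edges, the
same bound holds for `G - v` and `S \ {v}`; once `G - v` has been replaced by a graph with the same
degrees that contains the gem, the edges at `v` are put back. For `|S| = 5` the graph `G - v` has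
six edges on four vertices, so it is a `K₄`, and `v` has at least two neighbours in it. In the
exceptional case a realization is built directly: start from the wheel on five vertices and
repeatedly insert a vertex of degree `3`, by subdividing an edge outside the gem and joining the new
vertex to a further vertex. One half of the subdivided edge is again an edge outside the gem.

The sequence `((n-1)², 2ⁿ⁻²)` has only one realization. Its two dominating vertices form a vertex
cover, while every vertex cover of the gem has at least three vertices.
-/

namespace PotentiallyGraphic

open Finset SimpleGraph

variable {V : Type*}

section DegreeSeq

/-- The degrees of a graph, as a function on its vertices. It is defined through `Set.ncard`, as
`IsRealization` is, so that it needs no decidability instances; a vertex of infinite degree gets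
the value `0`. -/
noncomputable def degreeSeq (G : SimpleGraph V) : V → ℕ :=
  fun v => (G.neighborSet v).ncard

lemma isRealization_iff_degreeSeq_eq {n : ℕ} {G : SimpleGraph (Fin n)} {d : Fin n → ℕ} :
    IsRealization G d ↔ degreeSeq G = d :=
  funext_iff.symm

lemma degreeSeq_eq_degree (G : SimpleGraph V) (v : V) [Fintype (G.neighborSet v)] :
    degreeSeq G v = G.degree v :=
  Set.ncard_eq_toFinset_card' _

lemma degreeSeq_map {W : Type*} (f : V ↪ W) (G : SimpleGraph V) (v : V) :
    degreeSeq (G.map f) (f v) = degreeSeq G v := by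
  rw [degreeSeq, neighborSet_map, Set.ncard_image_of_injective _ f.injective, degreeSeq]

lemma degreeSeq_map_of_notMem_range {W : Type*} (f : V ↪ W) (G : SimpleGraph V) {w : W}
    (hw : w ∉ Set.range f) : degreeSeq (G.map f) w = 0 := by
  have h : (G.map f).neighborSet w = ∅ := by
    rw [neighborSet_eq_empty]
    rintro _ ⟨-, u, v, -, rfl, -⟩
    exact hw ⟨u, rfl⟩
  rw [degreeSeq, h, Set.ncard_empty]

lemma degreeSeq_eq_zero_iff_isIsolated [Finite V] {G : SimpleGraph V} {v : V} :
    degreeSeq G v = 0 ↔ G.IsIsolated v := by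
  rw [degreeSeq, Set.ncard_eq_zero, neighborSet_eq_empty]

lemma eq_of_le_of_degreeSeq_eq [Finite V] {G H : SimpleGraph V} (hle : G ≤ H)
    (h : degreeSeq G = degreeSeq H) : G = H := by
  ext v w
  exact Set.ext_iff.1 (Set.eq_of_subset_of_ncard_le (fun _ hw => hle hw) (congrFun h v).ge) w

lemma degreeSeq_sup [Finite V] {G H : SimpleGraph V} (h : Disjoint G H) :
    degreeSeq (G ⊔ H) = degreeSeq G + degreeSeq H := by
  ext v
  exact Set.ncard_union_eq (Set.disjoint_left.2 fun w hG hH => disjoint_left.1 h v w hG hH)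

lemma degreeSeq_edge [DecidableEq V] {u v : V} (huv : u ≠ v) :
    degreeSeq (edge u v) = Pi.single u 1 + Pi.single v 1 := by
  ext w
  have hw : (edge u v).neighborSet w = if w = u then {v} else if w = v then {u} else ∅ := by
    ext x
    simp only [mem_neighborSet, edge_adj]
    split_ifs <;> simp <;> grind
  rw [degreeSeq, hw]
  split_ifs with hu hv <;> simp [*]

lemma degreeSeq_sup_edge [Finite V] [DecidableEq V] {G : SimpleGraph V} {u v : V} (huv : u ≠ v)
    (h : ¬ G.Adj u v) :
    degreeSeq (G ⊔ edge u v) = degreeSeq G + (Pi.single u 1 + Pi.single v 1) := by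
  rw [degreeSeq_sup (G.disjoint_edge.2 h), degreeSeq_edge huv]

lemma sum_degreeSeq [Fintype V] (G : SimpleGraph V) :
    ∑ v, degreeSeq G v = 2 * G.edgeSet.ncard := by
  classical
  rw [← coe_edgeFinset, Set.ncard_coe_finset, ← sum_degrees_eq_twice_card_edges]
  simp only [degreeSeq_eq_degree]

lemma sum_degreeSeq_of_support_subset [Finite V] {G : SimpleGraph V} {S : Finset V}
    (hG : G.support ⊆ S) : ∑ v ∈ S, degreeSeq G v = 2 * G.edgeSet.ncard := by
  have := Fintype.ofFinite V
  rw [← sum_degreeSeq]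
  exact sum_subset (subset_univ S) fun v _ hv => degreeSeq_eq_zero_iff_isIsolated.2
    (G.notMem_support_iff_isIsolated.1 fun h => hv (hG h))

lemma ncard_edgeSet_deleteIncidenceSet_add [Finite V] (G : SimpleGraph V) (v : V) :
    (G.deleteIncidenceSet v).edgeSet.ncard + degreeSeq G v = G.edgeSet.ncard := by
  classical
  have := Fintype.ofFinite V
  simp only [← coe_edgeFinset, Set.ncard_coe_finset, card_edgeFinset_deleteIncidenceSet,
    degreeSeq_eq_degree]
  exact Nat.sub_add_cancel (G.degree_le_card_edgeFinset v)

lemma exists_ge_degreeSeq_eq_of_deleteIncidenceSet [Finite V] {G H : SimpleGraph V} {v : V}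
    (h : degreeSeq H = degreeSeq (G.deleteIncidenceSet v)) :
    ∃ K, H ≤ K ∧ degreeSeq K = degreeSeq G := by
  have hv : H.IsIsolated v := by
    rw [← degreeSeq_eq_zero_iff_isIsolated, h, degreeSeq_eq_zero_iff_isIsolated]
    exact fun w hvw => (deleteIncidenceSet_adj.1 hvw).2.1 rfl
  have hdisj : Disjoint H (G \ G.deleteIncidenceSet v) := by
    rw [SimpleGraph.disjoint_left]
    rintro x y hxy ⟨hG, hdel⟩
    refine hdel (deleteIncidenceSet_adj.2 ⟨hG, ?_, ?_⟩) <;> rintro rfl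
    exacts [hv y hxy, hv x hxy.symm]
  refine ⟨H ⊔ G \ G.deleteIncidenceSet v, le_sup_left, ?_⟩
  rw [degreeSeq_sup hdisj, h, ← degreeSeq_sup disjoint_sdiff_self_right,
    sup_sdiff_cancel_right (G.deleteIncidenceSet_le v)]

end DegreeSeq

lemma edgeSet_subset_image_offDiag [DecidableEq V] {G : SimpleGraph V} {S : Finset V}
    (hG : G.support ⊆ S) : G.edgeSet ⊆ (S.offDiag.image Sym2.mk.uncurry : Finset (Sym2 V)) := by
  intro e he
  induction e with
  | _ x y =>
    rw [mem_coe, mem_image]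
    exact ⟨(x, y), mem_offDiag.2 ⟨hG ⟨y, he⟩, hG ⟨x, he.symm⟩, he.ne⟩, rfl⟩

lemma ncard_edgeSet_le_choose_two {G : SimpleGraph V} {S : Finset V} (hG : G.support ⊆ S) :
    G.edgeSet.ncard ≤ (#S).choose 2 := by
  classical
  rw [← Sym2.card_image_offDiag, ← Set.ncard_coe_finset]
  exact Set.ncard_le_ncard (edgeSet_subset_image_offDiag hG)

lemma isClique_of_choose_two_le_ncard_edgeSet {G : SimpleGraph V} {S : Finset V}
    (hG : G.support ⊆ S) (hcard : (#S).choose 2 ≤ G.edgeSet.ncard) : G.IsClique S := by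
  classical
  rw [← Sym2.card_image_offDiag, ← Set.ncard_coe_finset] at hcard
  have heq := Set.eq_of_subset_of_ncard_le (edgeSet_subset_image_offDiag hG) hcard
  intro x hx y hy hxy
  rw [← mem_edgeSet, heq, mem_coe, mem_image]
  exact ⟨(x, y), mem_offDiag.2 ⟨hx, hy, hxy⟩, rfl⟩

section Gem

lemma K5MinusP3_adj {i j : Fin 5} : K5MinusP3.Adj i j ↔
    i ≠ j ∧ (i = 4 ∨ j = 4 ∨ s(i, j) = s(2, 0) ∨ s(i, j) = s(0, 3) ∨ s(i, j) = s(3, 1)) := by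
  simp only [K5MinusP3, pathThree, deleteEdges_adj, top_adj, edgeSet_fromEdgeSet, Set.mem_sdiff,
    Set.mem_insert_iff, Set.mem_singleton_iff, Sym2.mem_diagSet]
  revert i j
  decide

instance : DecidableRel K5MinusP3.Adj := fun _ _ => decidable_of_iff _ K5MinusP3_adj.symm

lemma degreeSeq_K5MinusP3 : degreeSeq K5MinusP3 = ![3, 2, 2, 3, 4] := by
  ext i
  rw [degreeSeq_eq_degree]
  revert i
  decide

lemma three_le_vertexCoverNum_K5MinusP3 : 3 ≤ K5MinusP3.vertexCoverNum := by
  obtain ⟨s, hs, hcover⟩ := vertexCoverNum_exists K5MinusP3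
  have key : ∀ t : Finset (Fin 5), (∀ i j, K5MinusP3.Adj i j → i ∈ t ∨ j ∈ t) → 3 ≤ #t := by
    decide
  classical
  rw [← hs, ← s.coe_toFinset, Set.encard_coe_eq_coe_finsetCard]
  exact_mod_cast key s.toFinset fun i j h => by simpa using hcover h

lemma K5MinusP3_isContained_of_path {G : SimpleGraph V} {v a b c d : V}
    (hva : G.Adj v a) (hvb : G.Adj v b) (hvc : G.Adj v c) (hvd : G.Adj v d)
    (hab : G.Adj a b) (hbc : G.Adj b c) (hcd : G.Adj c d)
    (hac : a ≠ c) (had : a ≠ d) (hbd : b ≠ d) : K5MinusP3.IsContained G := by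
  refine ⟨⟨⟨![b, d, a, c, v], ?_⟩, ?_⟩⟩
  · intro i j h
    fin_cases i <;> fin_cases j <;>
      first | exact absurd h (by decide) | assumption | exact Adj.symm (by assumption)
  · have := hva.ne; have := hvb.ne; have := hvc.ne; have := hvd.ne
    have := hab.ne; have := hbc.ne; have := hcd.ne
    simp [Function.Injective, Fin.forall_fin_succ, *, Ne.symm]

lemma K5MinusP3_isContained_of_isNClique_four {G : SimpleGraph V} {T : Finset V} {v : V}
    (hT : G.IsNClique 4 T) (hv : v ∉ T) (hsub : G.neighborSet v ⊆ T) (hdeg : 2 ≤ degreeSeq G v) :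
    K5MinusP3.IsContained G := by
  classical
  obtain ⟨a, ha, b, hb, hab⟩ := (Set.one_lt_ncard (T.finite_toSet.subset hsub)).1 hdeg
  have hcard : #((T.erase a).erase b) = 2 := by
    rw [card_erase_of_mem (mem_erase.2 ⟨hab.symm, hsub hb⟩), card_erase_of_mem (hsub ha),
      hT.card_eq]
  obtain ⟨c, d, hcd, hTcd⟩ := card_eq_two.1 hcard
  have hc : c ∈ (T.erase a).erase b := by simp [hTcd]
  have hd : d ∈ (T.erase a).erase b := by simp [hTcd]
  simp only [mem_erase] at hc hd
  have hadj : ∀ {x y}, x ∈ T → y ∈ T → x ≠ y → G.Adj x y := fun hx hy => hT.isClique hx hy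
  exact K5MinusP3_isContained_of_path ha.symm (hadj (hsub ha) (hsub hb) hab)
    (hadj (hsub ha) hc.2.2 hc.2.1.symm) (hadj (hsub ha) hd.2.2 hd.2.1.symm) hb
    (hadj (hsub hb) hc.2.2 hc.1.symm) (hadj hc.2.2 hd.2.2 hcd)
    (ne_of_mem_of_not_mem hc.2.2 hv).symm (ne_of_mem_of_not_mem hd.2.2 hv).symm hd.1.symm

end Gem

section SpareEdge

/-- `d` is the degree sequence of a graph that contains `H` and, in addition, an edge that does not
belong to that copy of `H` and avoids the vertex `c`. This edge is the one that is subdivided when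
a vertex of degree `3` is inserted; the extra vertex `c` is the third neighbour of the new
vertex. -/
def HasSpareEdgeRealization {W : Type*} (H : SimpleGraph W) (d : V → ℕ) (c : V) : Prop :=
  ∃ (G : SimpleGraph V) (y z : V), H.IsContained G ∧ y ≠ z ∧ y ≠ c ∧ z ≠ c ∧ ¬ G.Adj y z ∧
    degreeSeq (G ⊔ edge y z) = d

lemma degreeSeq_subdivide_edge [Finite V] [DecidableEq V] {G : SimpleGraph V} {x y z b : V}
    (hyz : y ≠ z) (hadj : ¬ G.Adj y z) (hx : G.IsIsolated x) (hxy : x ≠ y) (hxz : x ≠ z)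
    (hxb : x ≠ b) (hyb : y ≠ b) (hzb : z ≠ b) :
    degreeSeq (G ⊔ edge x y ⊔ edge x b ⊔ edge x z) =
      degreeSeq (G ⊔ edge y z) + (Pi.single x 3 + Pi.single b 1) := by
  have hb : ¬ (G ⊔ edge x y).Adj x b := by simp [edge_adj, hx b, hxy, hyb.symm]
  have hz : ¬ (G ⊔ edge x y ⊔ edge x b).Adj x z := by simp [edge_adj, hx z, hxy, hxb, hzb, hyz.symm]
  rw [degreeSeq_sup_edge hxz hz, degreeSeq_sup_edge hxb hb, degreeSeq_sup_edge hxy (hx y),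
    degreeSeq_sup_edge hyz hadj, show (3 : ℕ) = 1 + 1 + 1 from rfl, Pi.single_add, Pi.single_add]
  abel

lemma HasSpareEdgeRealization.insert_vertex [Finite V] [DecidableEq V] {W : Type*}
    {H : SimpleGraph W} {d : V → ℕ} {x b c : V} (h : HasSpareEdgeRealization H d b)
    (hdx : d x = 0) (hxb : x ≠ b) (hxc : x ≠ c) :
    HasSpareEdgeRealization H (d + (Pi.single x 3 + Pi.single b 1)) c := by
  obtain ⟨G, y, z, hH, hyz, hyb, hzb, hadj, rfl⟩ := h
  wlog hzc : z ≠ c generalizing y z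
  · exact edge_comm y z ▸ this z y hyz.symm hzb hyb (fun h => hadj h.symm) (edge_comm y z ▸ hdx)
      (fun hyc => hyz (hyc.trans (not_not.1 hzc).symm))
  have hxG : (G ⊔ edge y z).IsIsolated x := degreeSeq_eq_zero_iff_isIsolated.1 hdx
  have hxy : x ≠ y := by
    rintro rfl
    exact hxG z (by simp [edge_adj, hyz])
  have hxz : x ≠ z := by
    rintro rfl
    exact hxG y (by simp [edge_adj, hyz.symm])
  have hx : G.IsIsolated x := fun w hw => hxG w (Or.inl hw)
  refine ⟨G ⊔ edge x y ⊔ edge x b, x, z, hH.mono_right (le_sup_left.trans le_sup_left), hxz, hxc,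
    hzc, ?_, degreeSeq_subdivide_edge hyz hadj hx hxy hxz hxb hyb hzb⟩
  simp [edge_adj, hx z, hxy, hxb, hzb, hyz.symm]

end SpareEdge

lemma exists_embedding_map_univ_eq {S : Finset V} {k : ℕ} (hS : #S = k) {i j : Fin k} (hij : i ≠ j)
    {a b : V} (ha : a ∈ S) (hb : b ∈ S) (hab : a ≠ b) :
    ∃ f : Fin k ↪ V, univ.map f = S ∧ f i = a ∧ f j = b := by
  have e := (S.equivFinOfCardEq hS).symm
  obtain ⟨σ, hi, hj⟩ := (MulAction.is_two_pretransitive_iff (G := Equiv.Perm (Fin k))).1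
    (Equiv.Perm.isMultiplyPretransitive _ 2) hij
    (e.symm.injective.ne (show (⟨a, ha⟩ : S) ≠ ⟨b, hb⟩ from fun h => hab (congrArg Subtype.val h)))
  refine ⟨(σ.trans e).toEmbedding.trans (Function.Embedding.subtype _), ?_, ?_, ?_⟩
  · rw [← Finset.map_map, map_univ_equiv]
    exact S.attach_map_val
  · simp_all
  · simp_all

section Tight

/-- A sequence supported on `S` with terms at least `3` there and with sum `4 * #S - 4`. Among the
degree sequences of graphs on `S` with at least `2 * #S - 2` edges these are the only ones for which
the deletion of a vertex of minimum degree may not preserve that bound. -/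
structure IsTight (S : Finset V) (d : V → ℕ) : Prop where
  eq_zero : ∀ i ∉ S, d i = 0
  three_le : ∀ i ∈ S, 3 ≤ d i
  sum_add_four : ∑ i ∈ S, d i + 4 = 4 * #S

namespace IsTight

variable {S : Finset V} {d : V → ℕ}

lemma exists_four_le (h : IsTight S d) (hS : 5 ≤ #S) : ∃ b ∈ S, 4 ≤ d b := by
  by_contra! hlt
  have hle : ∑ i ∈ S, d i ≤ #S • 3 :=
    sum_le_card_nsmul S d 3 fun i hi => Nat.le_of_lt_succ (hlt i hi)
  have := h.sum_add_four
  rw [smul_eq_mul] at hle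
  omega

lemma exists_ne_eq_three (h : IsTight S d) {c : V} (hc : c ∈ S) :
    ∃ x ∈ S, x ≠ c ∧ d x = 3 := by
  classical
  by_contra! hne
  have hge : ∀ i ∈ S.erase c, 4 ≤ d i := fun i hi =>
    have ⟨hic, hiS⟩ := mem_erase.1 hi
    (h.three_le i hiS).lt_of_ne' (hne i hiS hic)
  have hle : #(S.erase c) • 4 ≤ ∑ i ∈ S.erase c, d i := card_nsmul_le_sum _ _ _ hge
  rw [smul_eq_mul] at hle
  have := add_sum_erase S d hc
  have := card_erase_add_one hc
  have := h.three_le c hc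
  have := h.sum_add_four
  omega

lemma erase_of_add_single [DecidableEq V] {x b : V}
    (h : IsTight S (d + (Pi.single x 3 + Pi.single b 1))) (hx : x ∈ S) (hb : b ∈ S) (hdx : d x = 0)
    (hdb : 3 ≤ d b) : IsTight (S.erase x) d := by
  obtain ⟨hzero, hthree, hsum⟩ := h
  simp only [Pi.add_apply, Pi.single_apply] at hzero hthree hsum
  refine ⟨fun i hi => ?_, fun i hi => ?_, ?_⟩
  · obtain rfl | hix := eq_or_ne i x
    · exact hdx
    · have := hzero i fun hiS => hi (mem_erase.2 ⟨hix, hiS⟩)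
      omega
  · obtain rfl | hib := eq_or_ne i b
    · exact hdb
    · simpa only [if_neg (ne_of_mem_erase hi), if_neg hib, add_zero] using
        hthree i (mem_of_mem_erase hi)
  · simp only [sum_add_distrib, sum_ite_eq', hx, hb, if_true] at hsum
    have := add_sum_erase S d hx
    have := card_erase_add_one hx
    omega

lemma exists_erase [DecidableEq V] (h : IsTight S d) (hS : 5 ≤ #S) {x : V} (hx : x ∈ S)
    (hdx : d x = 3) :
    ∃ b ∈ S.erase x, ∃ d', IsTight (S.erase x) d' ∧ d = d' + (Pi.single x 3 + Pi.single b 1) := by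
  obtain ⟨b, hb, hdb⟩ := h.exists_four_le hS
  have hbx : b ≠ x := by
    rintro rfl
    omega
  have hle : Pi.single x 3 + Pi.single b 1 ≤ d := by
    intro i
    simp only [Pi.add_apply, Pi.single_apply]
    split_ifs <;> subst_vars <;> omega
  obtain ⟨d', rfl⟩ := exists_add_of_le hle
  rw [add_comm] at h
  simp only [Pi.add_apply, Pi.single_eq_same, Pi.single_eq_of_ne hbx, Pi.single_eq_of_ne hbx.symm]
    at hdx hdb
  exact ⟨b, mem_erase.2 ⟨hbx, hb⟩, d', h.erase_of_add_single hx hb (by omega) (by omega),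
    add_comm _ _⟩

lemma hasSpareEdgeRealization_of_card_eq_five [Finite V] (h : IsTight S d) (hS : #S = 5) {c : V}
    (hc : c ∈ S) : HasSpareEdgeRealization K5MinusP3 d c := by
  classical
  obtain ⟨v, hv, hdv⟩ := h.exists_four_le hS.ge
  obtain ⟨a, ha, hav, hca⟩ : ∃ a ∈ S, a ≠ v ∧ (c = v ∨ c = a) := by
    by_cases hcv : c = v
    · obtain ⟨a, ha, hav⟩ := exists_mem_ne (by omega : 1 < #S) v
      exact ⟨a, ha, hav, .inl hcv⟩
    · exact ⟨c, hc, hcv, .inr rfl⟩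
  obtain ⟨f, rfl, rfl, rfl⟩ :=
    exists_embedding_map_univ_eq hS (show (4 : Fin 5) ≠ 0 by decide) hv ha hav.symm
  have hdf : ∀ j, d (f j) = (![3, 3, 3, 3, 4] : Fin 5 → ℕ) j := by
    have hsum := h.sum_add_four
    have hge := fun j => h.three_le (f j) (mem_map_of_mem f (mem_univ j))
    rw [sum_map, Fin.sum_univ_five, hS] at hsum
    have := hge 0
    have := hge 1
    have := hge 2
    have := hge 3
    intro j
    fin_cases j <;> dsimp <;> omega
  have hadj : ¬ (K5MinusP3.map f).Adj (f 1) (f 2) := by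
    rw [map_adj_apply]
    decide
  have hne : ∀ j, j ≠ 4 → j ≠ 0 → f j ≠ c := by
    rintro j h4 h0 rfl
    exact hca.elim (f.injective.ne h4) (f.injective.ne h0)
  refine ⟨K5MinusP3.map f, f 1, f 2, ⟨(Embedding.map f _).toCopy⟩, f.injective.ne (by decide),
    hne 1 (by decide) (by decide), hne 2 (by decide) (by decide), hadj, ?_⟩
  rw [degreeSeq_sup_edge (f.injective.ne (by decide)) hadj]
  ext w
  by_cases hw : w ∈ Set.range f
  · obtain ⟨j, rfl⟩ := hw
    simp only [Pi.add_apply, degreeSeq_map, degreeSeq_K5MinusP3, Pi.single_apply, hdf,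
      f.injective.eq_iff]
    revert j
    decide
  · have hd : d w = 0 := h.eq_zero w (by simpa using hw)
    simp only [Pi.add_apply, degreeSeq_map_of_notMem_range f _ hw, hd,
      Pi.single_eq_of_ne (ne_of_mem_of_not_mem (Set.mem_range_self _) hw).symm, add_zero]

lemma hasSpareEdgeRealization [Finite V] (h : IsTight S d) (hS : 5 ≤ #S) {c : V} (hc : c ∈ S) :
    HasSpareEdgeRealization K5MinusP3 d c := by
  classical
  induction S using Finset.strongInduction generalizing d c with
  | H S ih =>
    obtain hS5 | hS5 := hS.eq_or_lt
    · exact h.hasSpareEdgeRealization_of_card_eq_five hS5.symm hc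
    obtain ⟨x, hx, hxc, hdx⟩ := h.exists_ne_eq_three hc
    obtain ⟨b, hb, d', ht, rfl⟩ := h.exists_erase hS hx hdx
    have hcard : 5 ≤ #(S.erase x) := by
      rw [card_erase_of_mem hx]
      omega
    exact (ih (S.erase x) (erase_ssubset hx) ht hcard hb).insert_vertex
      (ht.eq_zero x (notMem_erase x S)) (ne_of_mem_erase hb).symm hxc

end IsTight

end Tight

section Deletion

lemma support_deleteIncidenceSet_subset_erase [DecidableEq V] {G : SimpleGraph V} {S : Finset V}
    {v : V} (hG : G.support ⊆ S) :
    (G.deleteIncidenceSet v).support ⊆ (S.erase v : Finset V) := by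
  rw [coe_erase]
  exact (G.support_deleteIncidenceSet_subset v).trans (Set.sdiff_subset_sdiff_left hG)

variable [Finite V] {G : SimpleGraph V} {S : Finset V} {v : V}

lemma two_mul_card_le_of_not_isTight (hG : G.support ⊆ S) (hcard : 2 * #S ≤ G.edgeSet.ncard + 2)
    (ht : ¬ IsTight S (degreeSeq G)) (hmin : ∀ w ∈ S, degreeSeq G v ≤ degreeSeq G w) :
    2 * #S ≤ (G.deleteIncidenceSet v).edgeSet.ncard + 4 := by
  have hdel := ncard_edgeSet_deleteIncidenceSet_add G v
  have hsum := sum_degreeSeq_of_support_subset hG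
  obtain hlt | heq | hgt := lt_trichotomy (degreeSeq G v) 3
  · omega
  · suffices 2 * #S ≠ G.edgeSet.ncard + 2 by omega
    refine fun h => ht ⟨fun i hi => ?_, fun i hi => heq ▸ hmin i hi, by omega⟩
    exact degreeSeq_eq_zero_iff_isIsolated.2
      (G.notMem_support_iff_isIsolated.1 fun h => hi (hG h))
  · have hle : #S • degreeSeq G v ≤ ∑ w ∈ S, degreeSeq G w := card_nsmul_le_sum _ _ _ hmin
    rw [smul_eq_mul, hsum] at hle
    -- `2 * (e - δ) ≥ δ * (#S - 2) ≥ 4 * (#S - 2)` for `e` edges and minimum degree `δ`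
    nlinarith

lemma K5MinusP3_isContained_of_card_eq_five (hG : G.support ⊆ S) (hS : #S = 5) (hv : v ∈ S)
    (hcard : 8 ≤ G.edgeSet.ncard) (hdel : 6 ≤ (G.deleteIncidenceSet v).edgeSet.ncard) :
    K5MinusP3.IsContained G := by
  classical
  have hS4 : #(S.erase v) = 4 := by rw [card_erase_of_mem hv, hS]
  have hsupp := support_deleteIncidenceSet_subset_erase (v := v) hG
  have hle := ncard_edgeSet_le_choose_two hsupp
  have hclique := isClique_of_choose_two_le_ncard_edgeSet hsupp (by rwa [hS4])
  have hadd := ncard_edgeSet_deleteIncidenceSet_add G v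
  rw [hS4, show Nat.choose 4 2 = 6 from rfl] at hle
  refine K5MinusP3_isContained_of_isNClique_four
    ⟨hclique.mono (G.deleteIncidenceSet_le v), hS4⟩ (notMem_erase v S) (fun w hw => ?_) (by omega)
  exact mem_erase.2 ⟨hw.ne', hG ⟨v, hw.symm⟩⟩

end Deletion

theorem exists_degreeSeq_eq_K5MinusP3_isContained [Finite V] {G : SimpleGraph V} {S : Finset V}
    (hG : G.support ⊆ S) (hS : 5 ≤ #S) (hcard : 2 * #S ≤ G.edgeSet.ncard + 2) :
    ∃ G', degreeSeq G' = degreeSeq G ∧ K5MinusP3.IsContained G' := by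
  classical
  induction S using Finset.strongInduction generalizing G with
  | H S ih =>
    have hne : S.Nonempty := card_pos.1 (by omega)
    by_cases ht : IsTight S (degreeSeq G)
    · obtain ⟨c, hc⟩ := hne
      obtain ⟨G', y, z, hcontained, -, -, -, -, hdeg⟩ := ht.hasSpareEdgeRealization hS hc
      exact ⟨G' ⊔ edge y z, hdeg, hcontained.mono_right le_sup_left⟩
    obtain ⟨v, hv, hmin⟩ := S.exists_min_image (degreeSeq G) hne
    have hdel := two_mul_card_le_of_not_isTight hG hcard ht hmin
    obtain hS5 | hS5 := hS.eq_or_lt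
    · exact ⟨G, rfl,
        K5MinusP3_isContained_of_card_eq_five hG hS5.symm hv (by omega) (by omega)⟩
    have hcard_erase := card_erase_add_one hv
    obtain ⟨H, hdeg, hcontained⟩ := ih (S.erase v) (erase_ssubset hv)
      (support_deleteIncidenceSet_subset_erase hG) (by omega) (by omega)
    obtain ⟨G', hle, hdeg'⟩ := exists_ge_degreeSeq_eq_of_deleteIncidenceSet hdeg
    exact ⟨G', hdeg', hcontained.mono_right hle⟩

theorem isPotentially_K5MinusP3_of_sum_ge {n : ℕ} (hn : 5 ≤ n) {d : Fin n → ℕ} (hd : IsGraphic d)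
    (hsum : 4 * n - 4 ≤ ∑ i, d i) : IsPotentially K5MinusP3 d := by
  obtain ⟨hanti, G, hG⟩ := hd
  rw [isRealization_iff_degreeSeq_eq] at hG
  subst hG
  rw [sum_degreeSeq] at hsum
  obtain ⟨G', hdeg, hcontained⟩ := exists_degreeSeq_eq_K5MinusP3_isContained (G := G) (S := univ)
    (by simp) (by simpa) (by rw [card_univ, Fintype.card_fin]; omega)
  exact ⟨hanti, G', isRealization_iff_degreeSeq_eq.2 hdeg, hcontained⟩

section Extremal

/-- The complete split graph with dominating set `T`: the vertices of `T` are adjacent to all other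
vertices, and the remaining vertices are pairwise nonadjacent. -/
def completeSplit (T : Finset V) : SimpleGraph V where
  Adj u v := u ≠ v ∧ (u ∈ T ∨ v ∈ T)
  symm := ⟨fun _ _ h => ⟨h.1.symm, h.2.symm⟩⟩
  loopless := ⟨fun _ h => h.1 rfl⟩

lemma degreeSeq_completeSplit [Fintype V] [DecidableEq V] (T : Finset V) :
    degreeSeq (completeSplit T) = fun v => if v ∈ T then Fintype.card V - 1 else #T := by
  ext v
  have hv : (completeSplit T).neighborSet v = ((if v ∈ T then univ.erase v else T : Finset V) :
      Set V) := by
    ext w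
    simp only [mem_neighborSet, completeSplit]
    split_ifs with h
    · simp [h, eq_comm]
    · simpa [h] using fun hw => (ne_of_mem_of_not_mem hw h).symm
  rw [degreeSeq, hv, Set.ncard_coe_finset]
  split_ifs
  · rw [card_erase_of_mem (mem_univ v), card_univ]
  · rfl

lemma isVertexCover_completeSplit (T : Finset V) : (completeSplit T).IsVertexCover T :=
  fun _ _ h => h.2

lemma eq_completeSplit_of_degreeSeq_eq [Finite V] {G : SimpleGraph V} {T : Finset V}
    (h : degreeSeq G = degreeSeq (completeSplit T)) : G = completeSplit T := by
  classical
  have := Fintype.ofFinite V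
  have hle : completeSplit T ≤ G := by
    have key : ∀ u ∈ T, ∀ v, u ≠ v → G.Adj u v := by
      intro u hu v huv
      have hdeg : degreeSeq G u = Fintype.card V - 1 := by
        simp only [h, degreeSeq_completeSplit, hu, if_true]
      rw [degreeSeq_eq_degree, degree_eq_card_sub_one] at hdeg
      exact hdeg huv
    rintro u v ⟨huv, hu | hv⟩
    exacts [key u hu v huv, (key v hv u huv.symm).symm]
  exact (eq_of_le_of_degreeSeq_eq hle h.symm).symm

variable {n : ℕ}

lemma degreeSeq_completeSplit_eq_extremalSeq (hn : 2 ≤ n) :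
    degreeSeq (completeSplit {i : Fin n | (i : ℕ) < 2}) = extremalSeq n := by
  rw [degreeSeq_completeSplit, Fin.card_filter_val_lt, min_eq_right hn, Fintype.card_fin]
  simp only [mem_filter_univ]
  rfl

lemma antitone_extremalSeq (n : ℕ) : Antitone (extremalSeq n) := by
  intro i j h
  have : (i : ℕ) ≤ j := h
  simp only [extremalSeq]
  split_ifs <;> omega

lemma isGraphic_extremalSeq (hn : 2 ≤ n) : IsGraphic (extremalSeq n) :=
  ⟨antitone_extremalSeq n, _,
    isRealization_iff_degreeSeq_eq.2 (degreeSeq_completeSplit_eq_extremalSeq hn)⟩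

lemma extremalSeq_pos (hn : 2 ≤ n) (i : Fin n) : 0 < extremalSeq n i := by
  simp only [extremalSeq]
  split_ifs <;> omega

lemma sum_extremalSeq (hn : 2 ≤ n) : ∑ i, extremalSeq n i = 4 * n - 6 := by
  have hcard := card_filter_add_card_filter_not (s := univ) fun i : Fin n => (i : ℕ) < 2
  simp only [Fin.card_filter_val_lt, min_eq_right hn, card_univ, Fintype.card_fin] at hcard
  simp only [extremalSeq, sum_ite, sum_const, smul_eq_mul, Fin.card_filter_val_lt, min_eq_right hn]
  omega

lemma not_isPotentially_K5MinusP3_extremalSeq (hn : 2 ≤ n) :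
    ¬ IsPotentially K5MinusP3 (extremalSeq n) := by
  rintro ⟨-, G, hG, hcontained⟩
  rw [isRealization_iff_degreeSeq_eq, ← degreeSeq_completeSplit_eq_extremalSeq hn] at hG
  rw [eq_completeSplit_of_degreeSeq_eq hG] at hcontained
  have hle : K5MinusP3.vertexCoverNum ≤ 2 := by
    refine (hcontained.vertexCoverNum_le_vertexCoverNum.trans
      (isVertexCover_completeSplit _).vertexCoverNum_le).trans ?_
    rw [Set.encard_coe_eq_coe_finsetCard, Fin.card_filter_val_lt, min_eq_right hn]
    rfl
  exact absurd (three_le_vertexCoverNum_K5MinusP3.trans hle) (by decide)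

end Extremal

end PotentiallyGraphic

theorem theorem4p1 (n : ℕ) (hn : 5 ≤ n) :
    PotentiallyGraphic.IsSigma PotentiallyGraphic.K5MinusP3 n (4 * n - 4) ∧
    (∀ d : Fin n → ℕ, PotentiallyGraphic.IsGraphic d → 4 * n - 4 ≤ ∑ i, d i →
      PotentiallyGraphic.IsPotentially PotentiallyGraphic.K5MinusP3 d) ∧
    (PotentiallyGraphic.IsGraphic (PotentiallyGraphic.extremalSeq n) ∧
      (∀ i, 0 < PotentiallyGraphic.extremalSeq n i) ∧
      ∑ i, PotentiallyGraphic.extremalSeq n i = 4 * n - 6 ∧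
      ¬ PotentiallyGraphic.IsPotentially PotentiallyGraphic.K5MinusP3
        (PotentiallyGraphic.extremalSeq n)) := by
  open PotentiallyGraphic in
  have hn2 : 2 ≤ n := by omega
  have hgraphic := isGraphic_extremalSeq hn2
  have hpos := extremalSeq_pos hn2
  have hsum := sum_extremalSeq hn2
  have hnot := not_isPotentially_K5MinusP3_extremalSeq hn2
  refine ⟨⟨⟨⟨2 * n - 2, by omega⟩, fun d hd _ h => isPotentially_K5MinusP3_of_sum_ge hn hd h⟩, ?_⟩,
    fun d hd h => isPotentially_K5MinusP3_of_sum_ge hn hd h, hgraphic, hpos, hsum, hnot⟩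
  rintro l ⟨⟨k, hk⟩, hl⟩
  by_contra! hlt
  exact hnot (hl _ hgraphic hpos (by omega))
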